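/- \textbf{Model.} The running time of an algorithm is the number of ring operations (additions, subtractions, multiplications) in $\mathbf{C}$ performed by it; an algorithm for inputs of a given size is a straight-line program over $\mathbf{C}$, in which fixed complex constants are available at no cost. Fix, for every $n$, an algorithm that multiplies two polynomials in $\mathbf{C}[x]$ of degree less than $n$, and let $M(n)$ be its running time. Fix, for every $n$, an algorithm that computes the Fourier transform $\mathcal{F}_n(g) = (g(\omega^j))_{0 \le j < n}$, $\omega = e^{2\pi i/n}$, of a polynomial $g \in \mathbf{C}[x]$ of degree less than $n$, and let $T(n)$ be its running time. Assume: \begin{itemize} \item $M(n)/n \to \infty$ as $n \to \infty$, and $M(n)/n$ is nondecreasing up to a factor $1+o(1)$; that is, for every $\epsilon > 0$ we have $M(m)/m \le (1+\epsilon) M(n)/n$ for all sufficiently large $m$ and all $n \ge m$. \item $T(2n) = (1/3 + o(1)) M(n)$ as $n \to \infty$ along some set $S$ of integers that is sufficiently dense, in the sense that there is a constant $C$ such that every interval $[N, CN]$ with $N \ge 1$ meets $S$. \end{itemize} \textbf{Theorem.} Let $f \in \mathbf{C}[[x]]$ with $f = 0 \bmod x$. Then $\exp f$ may be computed to order $n$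 in time $(13/6 + o(1)) M(n)$. That is, there are, for every $n$, an algorithm that computes $\exp f \bmod x^n$ from $f \bmod x^n$, for every $f \in \mathbf{C}[[x]]$ with $f = 0 \bmod x$, and a sequence $\eta_n \to 0$, such that the running time of the $n$-th algorithm is at most $(13/6 + \eta_n) M(n)$ for all sufficiently large $n$. -/

import Mathlib

open Filter Topology

noncomputable section

/-- The ring operations of `ℂ`. -/
inductive RingOp where
  | add
  | sub
  | mul

/-- The value of a ring operation. -/
def RingOp.eval : RingOp → ℂ → ℂ → ℂ
  | .add, a, b => a + b
  | .sub, a, b => a - b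
  | .mul, a, b => a * b

/-- Straight-line programs over `ℂ` whose results are indexed by `κ` and whose available values
are indexed by `ι` (initially the inputs).  An operand is an available value (`Sum.inl`) or a fixed
complex constant (`Sum.inr`).  A `step` performs one ring operation on two operands and adds
its result to the available values, under the new index `none`.  A program ends by naming, for each
`k : κ`, the operand that is its `k`-th result. -/
inductive StraightLine (κ : Type) : Type → Type 1 where
  | output {ι : Type} (out : κ → ι ⊕ ℂ) : StraightLine κ ι
  | step {ι : Type} (op : RingOp) (a b : ι ⊕ ℂ) (rest : StraightLine κ (Option ι)) :
      StraightLine κ ι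

namespace StraightLine

/-- The results of a program on the inputs `v`. -/
def eval {κ : Type} : {ι : Type} → StraightLine κ ι → (ι → ℂ) → κ → ℂ
  | _, output out, v => fun k => (out k).elim v id
  | _, step op a b rest, v =>
      rest.eval (fun i => i.elim (op.eval (a.elim v id) (b.elim v id)) v)

/-- The running time of a program: the number of ring operations it performs.  Every addition,
subtraction and multiplication counts, including those with a constant operand. -/
def cost {κ : Type} : {ι : Type} → StraightLine κ ι → ℕ
  | _, output _ => 0
  | _, step _ _ _ rest => rest.cost + 1

/-- `p` multiplies polynomials of degree less than `n`: from the coefficients of `f` and `g` it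
computes those of `f * g`, which has degree less than `2 * n`. -/
def Multiplies (n : ℕ) (p : StraightLine (Fin (2 * n)) (Fin n ⊕ Fin n)) : Prop :=
  ∀ f g : Polynomial ℂ, f.degree < (n : WithBot ℕ) → g.degree < (n : WithBot ℕ) →
    ∀ k : Fin (2 * n),
      p.eval (Sum.elim (fun i => f.coeff (i : ℕ)) (fun i => g.coeff (i : ℕ))) k =
        (f * g).coeff (k : ℕ)

/-- `p` computes the Fourier transform of length `n`: from the coefficients of a polynomial `g` of
degree less than `n` it computes the values `g (ω ^ j)`, `0 ≤ j < n`, with `ω = exp (2 π i / n)`. -/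
def ComputesFourier (n : ℕ) (p : StraightLine (Fin n) (Fin n)) : Prop :=
  ∀ g : Polynomial ℂ, g.degree < (n : WithBot ℕ) →
    ∀ j : Fin n, p.eval (fun i => g.coeff (i : ℕ)) j =
      g.eval (Complex.exp (2 * (Real.pi : ℂ) * Complex.I / (n : ℂ)) ^ (j : ℕ))

/-- `p` computes exponentials of power series to order `n`: for every power series `f` with zero
constant term it computes `exp f mod x ^ n` from `f mod x ^ n`. -/
def ComputesExp (n : ℕ) (p : StraightLine (Fin n) (Fin n)) : Prop :=
  ∀ f : PowerSeries ℂ, PowerSeries.constantCoeff f = 0 →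
    ∀ k : Fin n, p.eval (fun i => PowerSeries.coeff (i : ℕ) f) k =
      PowerSeries.coeff (k : ℕ) (PowerSeries.subst f (PowerSeries.exp ℂ) : PowerSeries ℂ)

end StraightLine

/-- A set of natural numbers that meets every interval `[N, C * N]`, `N ≥ 1`, for some constant
`C`; for instance the set of powers of two. -/
def GeometricallyDense (S : Set ℕ) : Prop :=
  ∃ C : ℕ, ∀ N : ℕ, 1 ≤ N → ∃ m ∈ S, N ≤ m ∧ m ≤ C * N

/-- `M n / n` tends to infinity. -/
def Superlinear (M : ℕ → ℕ) : Prop :=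
  Tendsto (fun n : ℕ => (M n : ℝ) / (n : ℝ)) atTop atTop

/-- `M n / n` is nondecreasing up to a factor `1 + o(1)`: one has
`M m / m ≤ (1 + o(1)) * (M n / n)` for `m ≤ n`, as `m` tends to infinity. -/
def AlmostNondecreasingQuotient (M : ℕ → ℕ) : Prop :=
  ∀ ε : ℝ, 0 < ε → ∀ᶠ m : ℕ in atTop, ∀ n : ℕ, m ≤ n →
    (M m : ℝ) / (m : ℝ) ≤ (1 + ε) * ((M n : ℝ) / (n : ℝ))

end

/-! Put `θ = x d/dx`, `G = exp f` and `D = θ f`, so that `θ G = D G`. Series are cut into blocks of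
length `m`, and the transforms of length `2m` of their blocks are kept and reused. A block of a
product then costs one inverse transform plus pointwise work (`coeff_mul_eq_hatMul`).

Let `2sm` be about `n`, and let `G₀` consist of the first `s` blocks of `G`. Start from `exp f` and
`exp (-f)` to order `m`. The blocks of `G₀` come from integrating the differential equation
blockwise (`coeff_residual`), at six transforms per block. The quotient `q = θ G₀ / G₀` agrees with
`D` on its first `s` blocks, so only the next `s` need computing. Blockwise division
(`coeff_division`) spends four transforms on each. Since `G / G₀ = 1 + O(x^(sm))`, its logarithmic
derivative `D - q` determines it linearly to order `2sm`. Multiplying back by `G₀` gives the second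
half of `G` at two transforms per block (`coeff_newton`). With `s` transforms for `D` the count is
`13s + 2`.

Since `T(2m) ~ M(m)/3`, `M(m) ≲ (m/n) M(n)` and `sm ~ n/2`, the transforms cost about `(13/6) M(n)`.
The block length is taken from `S` with `n/m` large but bounded. The pointwise work `O(s³ m)` is
then `O(n) = o(M(n))`, and the two shorter exponentials cost a small multiple of `M(n)`, once a
crude bound `O(M + 1)` is known (`exists_linear_bound`). -/

noncomputable section

/-! ### Cost calculus for straight-line programs. -/

/-- `Avail A x`: the value `x`, a function of the inputs `Ω`, may serve as an operand when the
values in `A` are available. -/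
def Avail {Ω : Type} (A : Set (Ω → ℂ)) (x : Ω → ℂ) : Prop :=
  x ∈ A ∨ ∃ c : ℂ, x = fun _ => c

/-- `Reach c A A'`: from the available values `A` one gets to the available values `A'` with at
most `c` ring operations. -/
inductive Reach {Ω : Type} : ℕ → Set (Ω → ℂ) → Set (Ω → ℂ) → Prop
  | refl (c : ℕ) (A : Set (Ω → ℂ)) : Reach c A A
  | step {c : ℕ} {A A' : Set (Ω → ℂ)} (op : RingOp) (x y : Ω → ℂ) (hx : Avail A x)
      (hy : Avail A y) (h : Reach c (insert (fun ω => op.eval (x ω) (y ω)) A) A') :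
      Reach (c + 1) A A'

section Reach

variable {Ω : Type} {A A' A'' : Set (Ω → ℂ)} {x y : Ω → ℂ} {c d : ℕ}

theorem Avail.mono (h : Avail A x) (hA : A ⊆ A') : Avail A' x :=
  h.imp (fun h => hA h) id

theorem avail_const (A : Set (Ω → ℂ)) (a : ℂ) : Avail A (fun _ => a) := Or.inr ⟨a, rfl⟩

theorem Reach.subset (h : Reach c A A') : A ⊆ A' := by
  induction h with
  | refl => exact subset_rfl
  | step op x y hx hy h ih => exact (Set.subset_insert _ _).trans ih

theorem Avail.reach (h : Avail A x) (hA : Reach c A A') : Avail A' x := h.mono hA.subset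

theorem Reach.weaken (h : Reach c A A') (hcd : c ≤ d) : Reach d A A' := by
  induction h generalizing d with
  | refl => exact .refl _ _
  | step op x y hx hy h ih =>
    obtain ⟨d, rfl⟩ : ∃ e, d = e + 1 := ⟨d - 1, by omega⟩
    exact .step op x y hx hy (ih (by omega))

theorem Reach.trans (h : Reach c A A') (h' : Reach d A' A'') : Reach (c + d) A A'' := by
  induction h with
  | refl => exact h'.weaken (by omega)
  | @step c A A' op x y hx hy h ih =>
    rw [show c + 1 + d = c + d + 1 by omega]
    exact .step op x y hx hy (ih h')

theorem reach_op (op : RingOp) (hx : Avail A x) (hy : Avail A y) :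
    ∃ A', Reach 1 A A' ∧ Avail A' (fun ω => op.eval (x ω) (y ω)) :=
  ⟨_, .step (c := 0) op x y hx hy (.refl _ _), Or.inl (Set.mem_insert _ _)⟩

theorem reach_add (hx : Avail A x) (hy : Avail A y) :
    ∃ A', Reach 1 A A' ∧ Avail A' (fun ω => x ω + y ω) := reach_op .add hx hy

theorem reach_sub (hx : Avail A x) (hy : Avail A y) :
    ∃ A', Reach 1 A A' ∧ Avail A' (fun ω => x ω - y ω) := reach_op .sub hx hy

theorem reach_mul (hx : Avail A x) (hy : Avail A y) :
    ∃ A', Reach 1 A A' ∧ Avail A' (fun ω => x ω * y ω) := reach_op .mul hx hy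

/-- A loop with invariant `P`. -/
theorem reach_loop (P : ℕ → Set (Ω → ℂ) → Prop) (N c : ℕ) (h0 : P 0 A)
    (hstep : ∀ k < N, ∀ B, A ⊆ B → P k B → ∃ B', Reach c B B' ∧ P (k + 1) B') :
    ∃ A', Reach (N * c) A A' ∧ P N A' := by
  induction N with
  | zero => exact ⟨A, .refl _ _, h0⟩
  | succ N ih =>
    obtain ⟨B, hB, hP⟩ := ih fun k hk => hstep k (by omega)
    obtain ⟨B', hB', hP'⟩ := hstep N (by omega) B hB.subset hP
    exact ⟨B', (hB.trans hB').weaken (by rw [Nat.succ_mul]), hP'⟩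

/-- Independent computations, one after the other. -/
theorem reach_forall (P : ℕ → Set (Ω → ℂ) → Prop)
    (hP : ∀ k B B', P k B → B ⊆ B' → P k B') (N c : ℕ)
    (hstep : ∀ k < N, ∀ B, A ⊆ B → ∃ B', Reach c B B' ∧ P k B') :
    ∃ A', Reach (N * c) A A' ∧ ∀ k < N, P k A' := by
  refine reach_loop (fun k B => ∀ i < k, P i B) N c (by simp) fun k hk B hB hPk => ?_
  obtain ⟨B', hB', h⟩ := hstep k hk B hB
  refine ⟨B', hB', fun i hi => ?_⟩
  rcases Nat.lt_succ_iff_lt_or_eq.mp hi with hi | rfl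
  · exact hP i _ _ (hPk i hi) hB'.subset
  · exact h

theorem reach_forall_avail (x : ℕ → Ω → ℂ) (N c : ℕ)
    (hstep : ∀ k < N, ∀ B, A ⊆ B → ∃ B', Reach c B B' ∧ Avail B' (x k)) :
    ∃ A', Reach (N * c) A A' ∧ ∀ k < N, Avail A' (x k) :=
  reach_forall (fun k B => Avail B (x k)) (fun _ _ _ h hB => h.mono hB) N c hstep

theorem reach_sum (x : ℕ → Ω → ℂ) (N c : ℕ)
    (hstep : ∀ k < N, ∀ B, A ⊆ B → ∃ B', Reach c B B' ∧ Avail B' (x k)) :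
    ∃ A', Reach (N * (c + 1)) A A' ∧ Avail A' (fun ω => ∑ k ∈ Finset.range N, x k ω) := by
  refine reach_loop (fun k B => Avail B (fun ω => ∑ i ∈ Finset.range k, x i ω)) N (c + 1)
    (by simpa using avail_const A 0) fun k hk B hB hk' => ?_
  obtain ⟨B', hB', h⟩ := hstep k hk B hB
  obtain ⟨B'', hB'', h''⟩ := reach_add (hk'.reach hB') h
  exact ⟨B'', hB'.trans hB'', by simpa only [Finset.sum_range_succ] using h''⟩

theorem avail_elim {ι : Type} {a : ι → Ω → ℂ} (ha : ∀ i, Avail A (a i)) (o : ι ⊕ ℂ) :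
    Avail A (fun ω => o.elim (fun i => a i ω) id) := by
  cases o with
  | inl i => exact ha i
  | inr z => exact avail_const A z

/-- Running a program on available values. -/
theorem StraightLine.reach {κ ι : Type} (p : StraightLine κ ι) (a : ι → Ω → ℂ)
    (ha : ∀ i, Avail A (a i)) :
    ∃ A', Reach p.cost A A' ∧ ∀ k, Avail A' (fun ω => p.eval (fun i => a i ω) k) := by
  induction p generalizing A with
  | output out => exact ⟨A, .refl _ _, fun k => avail_elim ha (out k)⟩
  | @step ι op l r rest ih =>
    have hl := avail_elim ha l
    have hr := avail_elim ha r
    obtain ⟨B, hB, h⟩ := reach_op op hl hr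
    obtain ⟨A', hA', h'⟩ := ih (A := B)
      (fun i => i.elim (fun ω => op.eval (l.elim (fun i => a i ω) id) (r.elim (fun i => a i ω) id))
        a) (by
        rintro (_ | i)
        · exact h
        · exact (ha i).reach hB)
    refine ⟨A', (hB.trans hA').weaken (by simp [StraightLine.cost, add_comm]), fun k => ?_⟩
    convert h' k using 2 with ω
    simp only [StraightLine.eval]
    congr 1
    funext i
    cases i <;> rfl

/-- Compiling to a program. -/
theorem Reach.exists_straightLine {κ : Type} (h : Reach c A A') {ι : Type} (a : ι → Ω → ℂ)
    (ha : ∀ x ∈ A, ∃ i, x = a i) (b : κ → Ω → ℂ) (hb : ∀ k, Avail A' (b k)) :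
    ∃ p : StraightLine κ ι, p.cost ≤ c ∧ ∀ ω k, p.eval (fun i => a i ω) k = b k ω := by
  have operand : ∀ {A : Set (Ω → ℂ)} {ι : Type} {a : ι → Ω → ℂ}, (∀ x ∈ A, ∃ i, x = a i) →
      ∀ x, Avail A x → ∃ o : ι ⊕ ℂ, ∀ ω, o.elim (fun i => a i ω) id = x ω := by
    rintro A ι a ha x (hx | ⟨z, rfl⟩)
    · obtain ⟨i, rfl⟩ := ha x hx
      exact ⟨.inl i, fun ω => rfl⟩
    · exact ⟨.inr z, fun ω => rfl⟩
  induction h generalizing ι with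
  | refl =>
    choose out hout using fun k => operand ha (b k) (hb k)
    exact ⟨.output out, by simp [StraightLine.cost], fun ω k => hout k ω⟩
  | @step c A A' op x y hx hy h ih =>
    obtain ⟨l, hl⟩ := operand ha x hx
    obtain ⟨r, hr⟩ := operand ha y hy
    obtain ⟨p, hp, hp'⟩ := ih (ι := Option ι)
      (fun i => i.elim (fun ω => op.eval (x ω) (y ω)) a) (by
        rintro z (rfl | hz)
        · exact ⟨none, rfl⟩
        · obtain ⟨i, rfl⟩ := ha z hz
          exact ⟨some i, rfl⟩) hb
    refine ⟨.step op l r p, by simpa [StraightLine.cost] using hp, fun ω k => ?_⟩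
    rw [← hp' ω k]
    simp only [StraightLine.eval, hl, hr]
    congr 1
    funext i
    cases i <;> rfl

end Reach

open PowerSeries

/-! ### Power series identities behind the algorithm. -/

section Series

/-- The derivation `x * d/dx`. -/
def euler (F : ℂ⟦X⟧) : ℂ⟦X⟧ := X * d⁄dX ℂ F

theorem coeff_euler (F : ℂ⟦X⟧) (i : ℕ) : coeff i (euler F) = i * coeff i F := by
  cases i with
  | zero => simp [euler]
  | succ i => rw [euler, coeff_succ_X_mul, coeff_derivative]; push_cast; ring

theorem euler_mul (F G : ℂ⟦X⟧) : euler (F * G) = F * euler G + euler F * G := by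
  simp only [euler, Derivation.leibniz, smul_eq_mul]; ring

theorem euler_sub (F G : ℂ⟦X⟧) : euler (F - G) = euler F - euler G := by
  simp only [euler, map_sub]; ring

theorem euler_neg (F : ℂ⟦X⟧) : euler (-F) = -euler F := by
  simp only [euler, map_neg]; ring

theorem euler_X_pow (n : ℕ) : euler (X ^ n) = (n : ℂ⟦X⟧) * X ^ n := by
  ext i
  rw [coeff_euler, ← map_natCast (C (R := ℂ)), coeff_C_mul, coeff_X_pow]
  split_ifs with h <;> simp [h]

/-- The exponential of a power series. -/
def expSeries (f : ℂ⟦X⟧) : ℂ⟦X⟧ := subst f (PowerSeries.exp ℂ)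

theorem euler_expSeries {f : ℂ⟦X⟧} (hf : constantCoeff f = 0) :
    euler (expSeries f) = euler f * expSeries f := by
  rw [euler, expSeries, derivative_subst (.of_constantCoeff_zero' hf), derivative_exp, euler]
  ring

theorem constantCoeff_expSeries {f : ℂ⟦X⟧} (hf : constantCoeff f = 0) :
    constantCoeff (expSeries f) = 1 := by
  have h : PowerSeries.exp ℂ = 1 + (PowerSeries.exp ℂ - 1) := by ring
  have h0 : constantCoeff (subst f (PowerSeries.exp ℂ - 1) : ℂ⟦X⟧) = 0 :=
    constantCoeff_subst_eq_zero hf _ (by simp)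
  rw [expSeries, h, subst_add (.of_constantCoeff_zero' hf), map_add, h0,
    ← coe_substAlgHom (.of_constantCoeff_zero' hf), map_one]
  simp

/-- The derivation `euler` kills the product, so only its constant term survives. -/
theorem expSeries_mul_expSeries_neg {f : ℂ⟦X⟧} (hf : constantCoeff f = 0) :
    expSeries f * expSeries (-f) = 1 := by
  have hf' : constantCoeff (-f) = 0 := by simp [hf]
  have h : euler (expSeries f * expSeries (-f)) = 0 := by
    rw [euler_mul, euler_expSeries hf, euler_expSeries hf', euler_neg]; ring
  ext i
  rcases Nat.eq_zero_or_pos i with rfl | hi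
  · simp [constantCoeff_expSeries, hf]
  · have := congrArg (coeff i) h
    rw [coeff_euler, map_zero] at this
    rw [coeff_one, if_neg hi.ne']
    exact (mul_eq_zero.mp this).resolve_left (by exact_mod_cast hi.ne')

/-- `low N F = F mod x ^ N`. -/
def low (N : ℕ) (F : ℂ⟦X⟧) : ℂ⟦X⟧ := mk fun i => if i < N then coeff i F else 0

/-- The series `F`, without its first `N` terms, divided by `x ^ N`. -/
def shift (N : ℕ) (F : ℂ⟦X⟧) : ℂ⟦X⟧ := mk fun i => coeff (N + i) F

theorem coeff_low (N i : ℕ) (F : ℂ⟦X⟧) : coeff i (low N F) = if i < N then coeff i F else 0 :=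
  coeff_mk _ _

theorem coeff_shift (N i : ℕ) (F : ℂ⟦X⟧) : coeff i (shift N F) = coeff (N + i) F := coeff_mk _ _

theorem low_add_shift (N : ℕ) (F : ℂ⟦X⟧) : low N F + X ^ N * shift N F = F := by
  ext i
  rw [map_add, coeff_low, coeff_X_pow_mul']
  split_ifs with h h' h'
  · omega
  · simp
  · rw [coeff_shift, zero_add, Nat.add_sub_cancel' h']
  · omega

theorem coeff_add_X_pow_mul (N i : ℕ) (F : ℂ⟦X⟧) : coeff (N + i) (X ^ N * F) = coeff i F := by
  rw [add_comm, coeff_X_pow_mul]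

/-- Blockwise integration of `x * G' = D * G`: if `H = 1 / G` and `Y = H * shift N G`, then the
residual of `G mod x ^ N` is `x ^ N * G * (N * Y + x * Y')`. -/
theorem coeff_residual {G H D : ℂ⟦X⟧} (hGH : G * H = 1) (hG : euler G = D * G) (N i : ℕ) :
    coeff i (G * ((N : ℂ⟦X⟧) * (H * shift N G) + euler (H * shift N G))) =
      coeff (N + i) (D * low N G) := by
  set R := shift N G
  have hlow : low N G = G - X ^ N * R := by rw [eq_sub_iff_add_eq]; exact low_add_shift N G
  have key : X ^ N * (G * ((N : ℂ⟦X⟧) * (H * R) + euler (H * R))) =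
      D * low N G - euler (low N G) := by
    have h1 : G * euler (X ^ N * (H * R)) = X ^ N * (G * ((N : ℂ⟦X⟧) * (H * R) + euler (H * R))) := by
      rw [euler_mul, euler_X_pow]; ring
    -- The missing tail is `G` times `X ^ N * Y`; applying `euler` to this product makes the
    -- `D`-terms cancel, so no term in `D` is left to solve for.
    have h2 : X ^ N * R = G * (X ^ N * (H * R)) := by linear_combination (-(X ^ N * R)) * hGH
    rw [← h1, hlow, euler_sub, hG, h2, euler_mul G, hG]
    ring
  -- The term `euler (low N G)` has no coefficients in degrees at least `N`.
  rw [← coeff_add_X_pow_mul N, key, map_sub, coeff_euler, coeff_low _ _ G, if_neg (by omega)]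
  ring

/-- Multiplication by `H = 1 / G` turns the residual into `N * Y + euler Y`, a diagonal operator on
coefficients. For the first `m` coefficients of `Y` only the first `m` of `H` matter. -/
theorem coeff_mul_residual {G H : ℂ⟦X⟧} (hGH : G * H = 1) (Y : ℂ⟦X⟧) (N i : ℕ) :
    coeff i (G * ((N : ℂ⟦X⟧) * Y + euler Y) * H) = ((N + i : ℕ) : ℂ) * coeff i Y := by
  have : G * ((N : ℂ⟦X⟧) * Y + euler Y) * H = (N : ℂ⟦X⟧) * Y + euler Y := by
    linear_combination ((N : ℂ⟦X⟧) * Y + euler Y) * hGH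
  rw [this, map_add, coeff_euler, ← map_natCast (C (R := ℂ)), coeff_C_mul]
  push_cast; ring

/-- Blockwise division: if `q * G₀` vanishes in degrees at least `N`, the next coefficients of
`q` are given by the product of `G₀⁻¹` with those of `low N q * G₀`. -/
theorem coeff_division {G₀ H₀ q : ℂ⟦X⟧} (hGH : G₀ * H₀ = 1) (N : ℕ)
    (hq : ∀ i, coeff (N + i) (q * G₀) = 0) (i : ℕ) :
    coeff (N + i) q = -coeff i (shift N (low N q * G₀) * H₀) := by
  have h : shift N (low N q * G₀) = -(shift N q * G₀) := by
    ext j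
    rw [coeff_shift, map_neg, ← coeff_add_X_pow_mul N j (shift N q * G₀)]
    have := hq j
    rw [← low_add_shift N q, add_mul, map_add, mul_assoc] at this
    exact eq_neg_of_add_eq_zero_left this
  rw [h, show -(shift N q * G₀) * H₀ = -shift N q by linear_combination (-shift N q) * hGH,
    map_neg, neg_neg, coeff_shift]

/-- The logarithmic derivative of a truncation agrees with that of the series. -/
theorem coeff_logDeriv_low {G G₀ H₀ D : ℂ⟦X⟧} {N : ℕ} (hG : euler G = D * G) (hG₀ : G₀ = low N G)
    (hGH : G₀ * H₀ = 1) {i : ℕ} (hi : i < N) : coeff i (euler G₀ * H₀) = coeff i D := by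
  have h : euler G₀ = D * G₀ - X ^ N * ((N : ℂ⟦X⟧) * shift N G + euler (shift N G) - D * shift N G) := by
    have h' : G₀ = G - X ^ N * shift N G := by
      rw [hG₀, eq_sub_iff_add_eq]; exact low_add_shift N G
    rw [h', euler_sub, euler_mul, euler_X_pow, hG]; ring
  have h' : euler G₀ * H₀ =
      D + X ^ N * (-((N : ℂ⟦X⟧) * shift N G + euler (shift N G) - D * shift N G) * H₀) := by
    rw [h]; linear_combination D * hGH
  rw [h', map_add, coeff_X_pow_mul', if_neg (by omega), add_zero]

/-- Inverses of series congruent modulo `X ^ N` are congruent. Hence the known start of `exp (-f)`,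
with its transform, also serves as the start of `1 / G₀`. -/
theorem coeff_inv_low {G H G₀ H₀ : ℂ⟦X⟧} {N : ℕ} (hGH : G * H = 1) (hG₀ : G₀ = low N G)
    (hGH₀ : G₀ * H₀ = 1) {i : ℕ} (hi : i < N) : coeff i H₀ = coeff i H := by
  have hsplit : G₀ + X ^ N * shift N G = G := by rw [hG₀]; exact low_add_shift N G
  have : H₀ = H + X ^ N * (shift N G * H * H₀) := by
    linear_combination (-H₀) * hGH + H * hGH₀ - H * H₀ * hsplit
  rw [this, map_add, coeff_X_pow_mul', if_neg (by omega), add_zero]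

/-- The quotient `W` of the two exponentials has `euler W` divisible by `X ^ n` and constant term
one, so `W = 1 + O(x^n)`. This allows padding the input by zeros up to a whole number of blocks. -/
theorem coeff_expSeries_low {f : ℂ⟦X⟧} (hf : constantCoeff f = 0) {n i : ℕ} (hi : i < n) :
    coeff i (expSeries (low n f)) = coeff i (expSeries f) := by
  have hl : constantCoeff (low n f) = 0 := by
    rw [← coeff_zero_eq_constantCoeff_apply, coeff_low, coeff_zero_eq_constantCoeff_apply, hf,
      ite_self]
  have hl' : constantCoeff (-low n f) = 0 := by rw [map_neg, hl, neg_zero]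
  set W := expSeries f * expSeries (-low n f) with hW
  have hE : euler W =
      X ^ n * (((n : ℂ⟦X⟧) * shift n f + euler (shift n f)) * W) := by
    have h : euler f - euler (low n f) = X ^ n * ((n : ℂ⟦X⟧) * shift n f + euler (shift n f)) := by
      nth_rw 1 [← euler_sub, ← low_add_shift n f]
      rw [add_sub_cancel_left, euler_mul, euler_X_pow]; ring
    rw [← mul_assoc, ← h, hW, euler_mul, euler_expSeries hf, euler_expSeries hl', euler_neg]; ring
  have hW1 : W = 1 + X ^ n * shift n W := by
    nth_rw 1 [← low_add_shift n W]
    congr 1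
    ext j
    rw [coeff_low, coeff_one]
    rcases Nat.eq_zero_or_pos j with rfl | hj
    · rw [if_pos (by omega), if_pos rfl, coeff_zero_eq_constantCoeff_apply, hW, map_mul,
        constantCoeff_expSeries hf, constantCoeff_expSeries hl', one_mul]
    · rw [if_neg hj.ne']
      split_ifs with hjn
      · have := congrArg (coeff j) hE
        rw [coeff_euler, coeff_X_pow_mul', if_neg (by omega)] at this
        exact (mul_eq_zero.mp this).resolve_left (by exact_mod_cast hj.ne')
      · rfl
  have h2 : expSeries f = expSeries (low n f) + X ^ n * (shift n W * expSeries (low n f)) := by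
    linear_combination expSeries (low n f) * hW1 - expSeries (low n f) * hW -
      expSeries f * expSeries_mul_expSeries_neg hl
  rw [h2, map_add, coeff_X_pow_mul', if_neg (by omega), add_zero]

/-- The Newton step `G = G₀ * Z`, with `Z` the exponential of the error of the logarithm. -/
theorem coeff_newton {G G₀ H₀ D : ℂ⟦X⟧} {N : ℕ} (hN : 0 < N) (hG : euler G = D * G)
    (hG₀ : G₀ = low N G) (hGH : G₀ * H₀ = 1) :
    (∀ i, coeff (N + i) G = coeff i (shift N (G * H₀) * G₀)) ∧
      ∀ i < N, coeff i (shift N (G * H₀)) =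
        ((N + i : ℕ) : ℂ)⁻¹ * (coeff (N + i) D - coeff (N + i) (euler G₀ * H₀)) := by
  set Z := G * H₀ with hZ
  have hsplit : G = G₀ + X ^ N * shift N G := by rw [hG₀]; exact (low_add_shift N G).symm
  have hZ1 : Z = 1 + X ^ N * (shift N G * H₀) := by
    rw [hZ]; nth_rw 1 [hsplit]; linear_combination hGH
  have hshift : shift N Z = shift N G * H₀ := by
    ext i
    rw [coeff_shift, hZ1, map_add, coeff_add_X_pow_mul, coeff_one, if_neg (by omega), zero_add]
  refine ⟨fun i => ?_, fun i hi => ?_⟩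
  · rw [hshift, show shift N G * H₀ * G₀ = shift N G by linear_combination shift N G * hGH,
      coeff_shift]
  · have hE : euler Z = (D - euler G₀ * H₀) * Z := by
      have h1 : G = Z * G₀ := by rw [hZ]; linear_combination (-G) * hGH
      have h2 : euler G = Z * euler G₀ + euler Z * G₀ := by rw [← euler_mul, ← h1]
      linear_combination (-euler Z) * hGH - H₀ * h2 + H₀ * hG + euler G₀ * H₀ * hZ
    have hlow : D - euler G₀ * H₀ = X ^ N * shift N (D - euler G₀ * H₀) := by
      nth_rw 1 [← low_add_shift N (D - euler G₀ * H₀)]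
      rw [add_eq_right]
      ext j
      rw [coeff_low]
      split_ifs with hj
      · rw [map_sub, coeff_logDeriv_low hG hG₀ hGH hj, sub_self, map_zero]
      · simp
    have h3 : coeff (N + i) (euler Z) = coeff (N + i) (D - euler G₀ * H₀) := by
      -- The second-order term: both `D - euler G₀ * H₀` and `Z - 1` are divisible by `X ^ N`, so
      -- their product starts only in degree `2 * N`.
      have h4 : coeff i ((D - euler G₀ * H₀) * (shift N G * H₀)) = 0 := by
        rw [hlow, mul_assoc, coeff_X_pow_mul', if_neg (by omega)]
      rw [hE]
      nth_rw 1 [hZ1]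
      rw [mul_add, mul_one, map_add, mul_left_comm, coeff_add_X_pow_mul, h4, add_zero]
    rw [coeff_euler, map_sub] at h3
    rw [coeff_shift, ← h3, inv_mul_cancel_left₀]
    exact_mod_cast (by omega : N + i ≠ 0)

end Series

/-! ### Block products through Fourier transforms of length `2 * m`. -/

section Blocks

/-- The primitive root of unity of order `2 * m` used by the Fourier transform. -/
def zeta (m : ℕ) : ℂ := Complex.exp (2 * (Real.pi : ℂ) * Complex.I / ((2 * m : ℕ) : ℂ))

theorem zeta_isPrimitiveRoot {m : ℕ} (hm : 0 < m) : IsPrimitiveRoot (zeta m) (2 * m) :=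
  Complex.isPrimitiveRoot_exp _ (by omega)

/-- The Fourier transform of length `2 * m` of the `k`-th block of length `m` of `F`. -/
def hat (m : ℕ) (F : ℂ⟦X⟧) (k j : ℕ) : ℂ :=
  ∑ p ∈ Finset.range m, coeff (k * m + p) F * zeta m ^ (p * j)

theorem hat_congr {m : ℕ} {F G : ℂ⟦X⟧} {k : ℕ}
    (h : ∀ p < m, coeff (k * m + p) F = coeff (k * m + p) G) (j : ℕ) :
    hat m F k j = hat m G k j :=
  Finset.sum_congr rfl fun p hp => by rw [h p (Finset.mem_range.mp hp)]

theorem hat_low {m k a : ℕ} (h : a < k) (F : ℂ⟦X⟧) (j : ℕ) :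
    hat m (low (k * m) F) a j = hat m F a j :=
  hat_congr (fun p hp => by
    rw [coeff_low, if_pos]
    calc a * m + p < (a + 1) * m := by rw [add_mul]; omega
      _ ≤ k * m := Nat.mul_le_mul_right m h) j

theorem hat_low_of_le {m k a : ℕ} (h : k ≤ a) (F : ℂ⟦X⟧) (j : ℕ) :
    hat m (low (k * m) F) a j = 0 :=
  Finset.sum_eq_zero fun p _ => by
    have := Nat.mul_le_mul_right m h
    rw [coeff_low, if_neg (by omega), zero_mul]

/-- The weight with which the product of the `a`-th and the `b`-th transformed blocks enters the
transform whose lower half is the `k`-th block of the product. -/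
def weight (m k a b j : ℕ) : ℂ :=
  if a + b = k then 1 else if a + b + 1 = k then zeta m ^ (m * j) else 0

/-- The transform whose lower half is the `k`-th block of `F * G`. -/
def hatMul (m : ℕ) (F G : ℂ⟦X⟧) (k j : ℕ) : ℂ :=
  ∑ a ∈ Finset.range (k + 1), ∑ b ∈ Finset.range (k + 1),
    weight m k a b j * (hat m F a j * hat m G b j)

theorem sum_zeta_pow {m : ℕ} (hm : 0 < m) (e : ℕ) :
    ∑ j ∈ Finset.range (2 * m), zeta m ^ (e * j) = if 2 * m ∣ e then ((2 * m : ℕ) : ℂ) else 0 := by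
  simp_rw [pow_mul]
  split_ifs with h
  · rw [(zeta_isPrimitiveRoot hm).pow_eq_one_iff_dvd e |>.mpr h]
    simp
  · have h1 : zeta m ^ e ≠ 1 := fun h' => h ((zeta_isPrimitiveRoot hm).pow_eq_one_iff_dvd e |>.mp h')
    rw [geom_sum_eq h1, ← pow_mul, mul_comm, pow_mul, (zeta_isPrimitiveRoot hm).pow_eq_one]
    simp

theorem sum_range_mul_eq (f : ℕ → ℂ) (K m : ℕ) :
    ∑ u ∈ Finset.range (K * m), f u =
      ∑ a ∈ Finset.range K, ∑ p ∈ Finset.range m, f (a * m + p) := by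
  induction K with
  | zero => simp
  | succ K ih => rw [Nat.succ_mul, Finset.sum_range_add, ih, Finset.sum_range_succ]

theorem coeff_mul_eq_sum_blocks (F G : ℂ⟦X⟧) (m k i : ℕ) (hi : i < m) :
    coeff (k * m + i) (F * G) =
      ∑ a ∈ Finset.range (k + 1), ∑ b ∈ Finset.range (k + 1), ∑ p ∈ Finset.range m,
        ∑ q ∈ Finset.range m, if a * m + p + (b * m + q) = k * m + i then
          coeff (a * m + p) F * coeff (b * m + q) G else 0 := by
  have hlt : k * m + i < (k + 1) * m := by rw [add_mul]; omega
  have : coeff (k * m + i) (F * G) = ∑ u ∈ Finset.range ((k + 1) * m),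
      ∑ v ∈ Finset.range ((k + 1) * m),
        if u + v = k * m + i then coeff u F * coeff v G else 0 := by
    rw [coeff_mul, ← Finset.sum_product', ← Finset.sum_filter]
    refine Finset.sum_congr ?_ fun _ _ => rfl
    ext ⟨u, v⟩
    simp only [Finset.HasAntidiagonal.mem_antidiagonal, Finset.mem_filter, Finset.mem_product, Finset.mem_range]
    omega
  rw [this, sum_range_mul_eq]
  refine Finset.sum_congr rfl fun a _ => ?_
  simp_rw [sum_range_mul_eq]
  rw [Finset.sum_comm]

/-- Two offsets below `m` carry at most once, so a product of two blocks meets only two consecutive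
output blocks. -/
theorem block_index_iff {m k i a b p q : ℕ} (hi : i < m) (hp : p < m) (hq : q < m) :
    a * m + p + (b * m + q) = k * m + i ↔
      (a + b = k ∧ p + q = i) ∨ (a + b + 1 = k ∧ p + q = m + i) := by
  constructor
  · intro h
    have h' : (a + b) * m + (p + q) = k * m + i := by rw [add_mul]; omega
    rcases lt_trichotomy (a + b) k with hlt | heq | hgt
    · right
      obtain ⟨d, rfl⟩ : ∃ d, k = a + b + 1 + d := ⟨k - (a + b + 1), by omega⟩
      have : p + q = m + d * m + i := by
        have : (a + b + 1 + d) * m = (a + b) * m + m + d * m := by ring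
        omega
      have hd : d = 0 := by
        by_contra hd
        have := Nat.mul_le_mul_right m (Nat.one_le_iff_ne_zero.mpr hd)
        omega
      subst hd
      exact ⟨rfl, by omega⟩
    · left
      subst heq
      exact ⟨rfl, by omega⟩
    · have := Nat.mul_le_mul_right m (show k + 1 ≤ a + b from hgt)
      rw [add_mul] at this
      omega
  · rintro (⟨rfl, rfl⟩ | ⟨rfl, h⟩)
    · ring
    · linear_combination h

/-- The index at which a Fourier transform evaluates at `zeta m ^ (-i)`. -/
def negIndex (m i : ℕ) : ℕ := (2 * m - i) % (2 * m)

theorem dvd_negIndex_iff {m i e : ℕ} (hi : i < m) :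
    2 * m ∣ negIndex m i + e ↔ e % (2 * m) = i := by
  have : negIndex m i = if i = 0 then 0 else 2 * m - i := by
    unfold negIndex
    split_ifs with h
    · subst h; simp
    · exact Nat.mod_eq_of_lt (by omega)
  rw [this]
  have hd := Nat.div_add_mod e (2 * m)
  have hr := Nat.mod_lt e (show 0 < 2 * m by omega)
  split_ifs with h
  · subst h
    rw [zero_add, Nat.dvd_iff_mod_eq_zero]
  · constructor
    · rintro ⟨t, ht⟩
      have h1 : e + 2 * m = i + 2 * m * t := by omega
      have h2 : (e + 2 * m) % (2 * m) = (i + 2 * m * t) % (2 * m) := by rw [h1]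
      rwa [Nat.add_mod_right, Nat.add_mul_mod_self_left,
        Nat.mod_eq_of_lt (show i < 2 * m by omega)] at h2
    · intro h'
      refine ⟨e / (2 * m) + 1, ?_⟩
      rw [mul_add]
      omega

/-- Block products with `a + b = k` contribute their lower half to block `k`, those with `a + b + 1
= k` their upper half. The factor `zeta m ^ (m * j)` is multiplication by `x ^ m` modulo `x ^ (2 *
m) - 1`, which swaps halves. One inverse transform of the combined sum therefore suffices; it is a
forward transform read at negated indices and divided by `2 * m`. -/
theorem coeff_mul_eq_hatMul (F G : ℂ⟦X⟧) {m i : ℕ} (k : ℕ) (hi : i < m) :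
    coeff (k * m + i) (F * G) = ((2 * m : ℕ) : ℂ)⁻¹ *
      ∑ j ∈ Finset.range (2 * m), hatMul m F G k j * zeta m ^ (j * negIndex m i) := by
  have hm : 0 < m := by omega
  have hm' : ((2 * m : ℕ) : ℂ) ≠ 0 := by exact_mod_cast (by omega : 2 * m ≠ 0)
  rw [eq_inv_mul_iff_mul_eq₀ hm', coeff_mul_eq_sum_blocks F G m k i hi, Finset.mul_sum]
  simp only [hatMul, Finset.sum_mul]
  rw [Finset.sum_comm]
  refine Finset.sum_congr rfl fun a _ => ?_
  rw [Finset.sum_comm (s := Finset.range (2 * m)), Finset.mul_sum]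
  refine Finset.sum_congr rfl fun b _ => ?_
  simp only [hat, Finset.sum_mul_sum]
  simp only [Finset.mul_sum, Finset.sum_mul]
  rw [Finset.sum_comm (s := Finset.range (2 * m))]
  refine Finset.sum_congr rfl fun p hp => ?_
  rw [Finset.sum_comm (s := Finset.range (2 * m))]
  refine Finset.sum_congr rfl fun q hq => ?_
  rw [Finset.mem_range] at hp hq
  have hsum (e : ℕ) : ∑ j ∈ Finset.range (2 * m),
      zeta m ^ (e * j) * (zeta m ^ (p * j) * zeta m ^ (q * j)) * zeta m ^ (j * negIndex m i) =
        if (e + p + q) % (2 * m) = i then ((2 * m : ℕ) : ℂ) else 0 := by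
    simp_rw [← dvd_negIndex_iff hi (e := e + p + q)]
    rw [← sum_zeta_pow hm]
    refine Finset.sum_congr rfl fun j _ => ?_
    rw [← pow_add, ← pow_add, ← pow_add]
    congr 1; ring
  have hcoeff (w : ℕ → ℂ) : ∑ j ∈ Finset.range (2 * m),
      w j * (coeff (a * m + p) F * zeta m ^ (p * j) * (coeff (b * m + q) G * zeta m ^ (q * j))) *
        zeta m ^ (j * negIndex m i) = coeff (a * m + p) F * coeff (b * m + q) G *
      ∑ j ∈ Finset.range (2 * m),
        w j * (zeta m ^ (p * j) * zeta m ^ (q * j)) * zeta m ^ (j * negIndex m i) := by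
    rw [Finset.mul_sum]
    exact Finset.sum_congr rfl fun j _ => by ring
  rw [hcoeff, if_congr (block_index_iff hi hp hq) rfl rfl]
  unfold weight
  by_cases h1 : a + b = k
  · have h2 : ¬ k + 1 = k := by omega
    have := hsum 0
    simp only [zero_mul, pow_zero, zero_add] at this
    simp only [h1, h2, if_true, true_and, false_and, or_false, this]
    rw [Nat.mod_eq_of_lt (by omega)]
    split_ifs <;> ring
  · by_cases h2 : a + b + 1 = k
    · simp only [h1, h2, if_true, if_false, true_and, false_and, false_or, hsum m]
      -- Since `p + q < 2 * m`, the shifted index wraps around at most once.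
      have : (m + p + q) % (2 * m) = i ↔ p + q = m + i := by
        constructor
        · intro h
          rcases lt_or_ge (m + p + q) (2 * m) with hlt | hge
          · rw [Nat.mod_eq_of_lt hlt] at h; omega
          · rw [Nat.mod_eq_sub_mod hge, Nat.mod_eq_of_lt (by omega)] at h; omega
        · intro h
          rw [show m + p + q = i + 2 * m by omega, Nat.add_mod_right, Nat.mod_eq_of_lt (by omega)]
      simp only [this]
      split_ifs <;> ring
    · simp [h1, h2]

end Blocks

/-! ### Computing one block, with transforms counted. -/

section BlockAlgorithms

variable {Ω : Type} {A A' : Set (Ω → ℂ)} {m s : ℕ}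

/-- The coefficients of `F` in degrees `lo ≤ i < hi` are available. -/
def AvailCoeff (A : Set (Ω → ℂ)) (F : Ω → ℂ⟦X⟧) (lo hi : ℕ) : Prop :=
  ∀ i, lo ≤ i → i < hi → Avail A fun ω => coeff i (F ω)

/-- The Fourier transform of the `k`-th block of `F` is available. -/
def AvailHat (m : ℕ) (A : Set (Ω → ℂ)) (F : Ω → ℂ⟦X⟧) (k : ℕ) : Prop :=
  ∀ j < 2 * m, Avail A fun ω => hat m (F ω) k j

theorem AvailCoeff.mono {F : Ω → ℂ⟦X⟧} {lo hi : ℕ} (h : AvailCoeff A F lo hi) (hA : A ⊆ A') :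
    AvailCoeff A' F lo hi := fun i h1 h2 => (h i h1 h2).mono hA

theorem AvailHat.mono {F : Ω → ℂ⟦X⟧} {k : ℕ} (h : AvailHat m A F k) (hA : A ⊆ A') :
    AvailHat m A' F k := fun j hj => (h j hj).mono hA

theorem AvailHat.congr {F G : Ω → ℂ⟦X⟧} {k : ℕ} (h : AvailHat m A F k)
    (hFG : ∀ ω, ∀ p < m, coeff (k * m + p) (F ω) = coeff (k * m + p) (G ω)) :
    AvailHat m A G k := fun j hj => by
  simpa only [fun ω => hat_congr (hFG ω) j] using h j hj

/-- Blocks not yet computed are replaced by zero, whose transform is free; block products can thus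
be formed on truncations. -/
theorem availHat_low {F : Ω → ℂ⟦X⟧} {k : ℕ} (h : ∀ a < k, AvailHat m A F a) (a : ℕ) :
    AvailHat m A (fun ω => low (k * m) (F ω)) a := fun j hj => by
  rcases lt_or_ge a k with hak | hak
  · simpa only [hat_low hak] using h a hak j hj
  · simpa only [hat_low_of_le hak] using avail_const A 0

theorem reach_fourier {p : StraightLine (Fin (2 * m)) (Fin (2 * m))}
    (hp : p.ComputesFourier (2 * m)) (u : ℕ → Ω → ℂ) (hu : ∀ i < 2 * m, Avail A (u i)) :
    ∃ A', Reach p.cost A A' ∧ ∀ j < 2 * m,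
      Avail A' fun ω => ∑ i ∈ Finset.range (2 * m), u i ω * zeta m ^ (i * j) := by
  obtain ⟨A', hA', h⟩ := p.reach (fun i ω => u i ω) fun i => hu i i.2
  refine ⟨A', hA', fun j hj => ?_⟩
  convert h ⟨j, hj⟩ using 2 with ω
  let g : Polynomial ℂ := ∑ i ∈ Finset.range (2 * m), Polynomial.monomial i (u i ω)
  have hcoeff : ∀ i : Fin (2 * m), g.coeff i = u i ω := fun i => by
    simp [g, Polynomial.coeff_monomial, i.2]
  have hdeg : g.degree < ((2 * m : ℕ) : WithBot ℕ) := by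
    rw [Polynomial.degree_lt_iff_coeff_zero]
    intro i hi
    simp only [g, Polynomial.finsetSum_coeff, Polynomial.coeff_monomial]
    exact Finset.sum_eq_zero fun l hl => if_neg (by have := Finset.mem_range.mp hl; omega)
  have := hp g hdeg ⟨j, hj⟩
  simp only [hcoeff] at this
  rw [this]
  simp only [g, Polynomial.eval_finsetSum, Polynomial.eval_monomial]
  refine Finset.sum_congr rfl fun i _ => ?_
  rw [mul_comm i j, pow_mul]
  rfl

theorem reach_hat {p : StraightLine (Fin (2 * m)) (Fin (2 * m))}
    (hp : p.ComputesFourier (2 * m)) (F : Ω → ℂ⟦X⟧) (k : ℕ) (hF : AvailCoeff A F (k * m) ((k + 1) * m)) :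
    ∃ A', Reach p.cost A A' ∧ AvailHat m A' F k := by
  obtain ⟨A', hA', h⟩ := reach_fourier hp
    (A := A) (fun i ω => if i < m then coeff (k * m + i) (F ω) else 0) (fun i _ => by
      by_cases h : i < m
      · simpa only [h, if_true] using hF _ (by omega) (by rw [add_mul]; omega)
      · simpa only [h, if_false] using avail_const A 0)
  refine ⟨A', hA', fun j hj => ?_⟩
  convert h j hj using 2 with ω
  rw [two_mul, Finset.sum_range_add, hat,
    Finset.sum_eq_zero (s := Finset.range m) (f := fun i => _ * zeta m ^ ((m + i) * j))
      fun i _ => by rw [if_neg (by omega), zero_mul], add_zero]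
  exact Finset.sum_congr rfl fun i hi => by rw [if_pos (Finset.mem_range.mp hi)]

/-- A block of a product, from the transformed blocks of the factors. -/
theorem reach_mul_block {p : StraightLine (Fin (2 * m)) (Fin (2 * m))}
    (hp : p.ComputesFourier (2 * m)) (F G : Ω → ℂ⟦X⟧) (k : ℕ) (hk : k < 2 * s)
    (hF : ∀ a ≤ k, AvailHat m A F a) (hG : ∀ a ≤ k, AvailHat m A G a) :
    ∃ A', Reach (p.cost + 30 * s ^ 2 * m) A A' ∧
      ∀ i < m, Avail A' fun ω => coeff (k * m + i) (F ω * G ω) := by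
  obtain ⟨B, hB, h⟩ := reach_forall_avail (A := A) (fun j ω => hatMul m (F ω) (G ω) k j) (2 * m)
    ((k + 1) * ((k + 1) * 3 + 1)) fun j hj B hB => by
      refine reach_sum (fun a ω => ∑ b ∈ Finset.range (k + 1),
        weight m k a b j * (hat m (F ω) a j * hat m (G ω) b j)) (k + 1) _ fun a ha B' hB' => ?_
      refine reach_sum (fun b ω => weight m k a b j * (hat m (F ω) a j * hat m (G ω) b j))
        (k + 1) 2 fun b hb B'' hB'' => ?_
      obtain ⟨C, hC, h⟩ := reach_mul
        (((hF a (by omega)).mono (hB.trans (hB'.trans hB''))) j hj)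
        (((hG b (by omega)).mono (hB.trans (hB'.trans hB''))) j hj)
      obtain ⟨C', hC', h'⟩ := reach_mul (avail_const C (weight m k a b j)) h
      exact ⟨C', hC.trans hC', h'⟩
  obtain ⟨B', hB', h'⟩ := reach_fourier hp (fun j ω => hatMul m (F ω) (G ω) k j) h
  obtain ⟨A', hA', h''⟩ := reach_forall_avail (A := B')
    (fun i ω => coeff (k * m + i) (F ω * G ω)) m 1 fun i hi C hC => by
      have hlt : negIndex m i < 2 * m := Nat.mod_lt _ (by omega)
      obtain ⟨C', hC', h⟩ := reach_mul (avail_const C ((2 * m : ℕ) : ℂ)⁻¹)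
        ((h' _ hlt).mono hC)
      exact ⟨C', hC', by simpa only [coeff_mul_eq_hatMul _ _ k hi] using h⟩
  refine ⟨A', ((hB.trans hB').trans hA').weaken ?_, h''⟩
  have h1 : (k + 1) * ((k + 1) * 3 + 1) ≤ (2 * s) * ((2 * s) * 3 + 1) := by gcongr <;> omega
  have h2 : s ≤ s ^ 2 := Nat.le_self_pow (by norm_num) s
  have h3 : 1 ≤ s ^ 2 := Nat.one_le_pow _ _ (by omega)
  -- With `k + 1 ≤ 2 * s` the left side is at most `24 * s ^ 2 + 4 * s + 1`.
  have h4 : 2 * ((k + 1) * ((k + 1) * 3 + 1)) + 1 ≤ 30 * s ^ 2 := by nlinarith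
  have h5 := Nat.mul_le_mul_right m h4
  nlinarith

/-- A block of a product of two series of which one is zero beyond its first block. -/
theorem reach_mul_block_zero {p : StraightLine (Fin (2 * m)) (Fin (2 * m))}
    (hp : p.ComputesFourier (2 * m)) (hs : 0 < s) (F G : Ω → ℂ⟦X⟧) (hF : AvailHat m A F 0)
    (hG : AvailHat m A G 0) :
    ∃ A', Reach (p.cost + 30 * s ^ 2 * m) A A' ∧
      ∀ i < m, Avail A' fun ω => coeff i (F ω * G ω) := by
  obtain ⟨A', hA', h⟩ := reach_mul_block hp (s := s) F G 0 (by omega)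
    (fun a ha => by rwa [Nat.le_zero.mp ha]) (fun a ha => by rwa [Nat.le_zero.mp ha])
  exact ⟨A', hA', fun i hi => by simpa using h i hi⟩

/-- One block of the exponential, by blockwise integration of `x * G' = D * G`. -/
theorem reach_exp_block {p : StraightLine (Fin (2 * m)) (Fin (2 * m))}
    (hp : p.ComputesFourier (2 * m)) {D G H : Ω → ℂ⟦X⟧} (hGH : ∀ ω, G ω * H ω = 1)
    (hG : ∀ ω, euler (G ω) = D ω * G ω) {k : ℕ} (hk : 0 < k) (hks : k < s)
    (hD : ∀ a ≤ k, AvailHat m A D a) (hGhat : ∀ a < k, AvailHat m A G a)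
    (hH : AvailHat m A H 0) :
    ∃ A', Reach (6 * p.cost + 4 * (30 * s ^ 2 * m)) A A' ∧
      AvailCoeff A' G (k * m) ((k + 1) * m) ∧ AvailHat m A' G k := by
  let Y : Ω → ℂ⟦X⟧ := fun ω => H ω * shift (k * m) (G ω)
  let W : Ω → ℂ⟦X⟧ := fun ω => G ω * (((k * m : ℕ) : ℂ⟦X⟧) * Y ω + euler (Y ω))
  obtain ⟨A₁, hA₁, h₁⟩ := reach_mul_block hp (s := s) D (fun ω => low (k * m) (G ω)) k (by omega)
    hD fun a _ => availHat_low hGhat a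
  have hW : AvailCoeff A₁ W (0 * m) ((0 + 1) * m) := fun i _ hi => by
    simpa only [W, Y, coeff_residual (hGH _) (hG _)] using h₁ i (by omega)
  obtain ⟨A₂, hA₂, h₂⟩ := reach_hat hp W 0 hW
  obtain ⟨A₃, hA₃, h₃⟩ := reach_mul_block_zero hp (s := s) (by omega) W H h₂
    ((hH.mono hA₁.subset).mono hA₂.subset)
  obtain ⟨A₄, hA₄, h₄⟩ := reach_forall_avail (A := A₃) (fun i ω => coeff i (Y ω)) m 1
    fun i hi B hB => by
      obtain ⟨B', hB', h⟩ := reach_mul (avail_const B ((k * m + i : ℕ) : ℂ)⁻¹) ((h₃ i hi).mono hB)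
      refine ⟨B', hB', ?_⟩
      -- Here `0 < k` is needed: integration cannot recover the constant term, which belongs to the
      -- given block `0`.
      have hne : ((k * m + i : ℕ) : ℂ) ≠ 0 := by
        have := Nat.mul_pos hk (show 0 < m by omega)
        exact_mod_cast (by omega : k * m + i ≠ 0)
      simpa only [W, coeff_mul_residual (hGH _), inv_mul_cancel_left₀ hne] using h
  obtain ⟨A₅, hA₅, h₅⟩ := reach_hat hp Y 0 fun i _ hi => h₄ i (by omega)
  have hA : Reach _ A A₅ := (((hA₁.trans hA₂).trans hA₃).trans hA₄).trans hA₅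
  obtain ⟨A₆, hA₆, h₆⟩ := reach_mul_block_zero hp (s := s) (by omega) G Y
    ((hGhat 0 hk).mono hA.subset) h₅
  have hGY : ∀ ω, G ω * Y ω = shift (k * m) (G ω) := fun ω => by
    simp only [Y]; linear_combination shift (k * m) (G ω) * hGH ω
  have hcoeff : AvailCoeff A₆ G (k * m) ((k + 1) * m) := fun i hi hi' => by
    rw [add_mul] at hi'
    have := h₆ (i - k * m) (by omega)
    simpa only [hGY, coeff_shift, Nat.add_sub_cancel' hi] using this
  obtain ⟨A₇, hA₇, h₇⟩ := reach_hat hp G k hcoeff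
  refine ⟨A₇, ((hA.trans hA₆).trans hA₇).weaken ?_, hcoeff.mono hA₇.subset, h₇⟩
  have : m ≤ 30 * s ^ 2 * m := Nat.le_mul_of_pos_left m (by have := pow_pos (show 0 < s by omega) 2; omega)
  omega

/-- One block of the logarithmic derivative of a truncation, by blockwise division. -/
theorem reach_logDeriv_block {p : StraightLine (Fin (2 * m)) (Fin (2 * m))}
    (hp : p.ComputesFourier (2 * m)) {G₀ H₀ q : Ω → ℂ⟦X⟧} (hGH : ∀ ω, G₀ ω * H₀ ω = 1) {k : ℕ}
    (hq : ∀ ω i, coeff (k * m + i) (q ω * G₀ ω) = 0) (hks : k < 2 * s)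
    (hqhat : ∀ a < k, AvailHat m A q a) (hG : ∀ a ≤ k, AvailHat m A G₀ a)
    (hH : AvailHat m A H₀ 0) :
    ∃ A', Reach (4 * p.cost + 3 * (30 * s ^ 2 * m)) A A' ∧
      AvailCoeff A' q (k * m) ((k + 1) * m) ∧ AvailHat m A' q k := by
  obtain ⟨A₁, hA₁, h₁⟩ := reach_mul_block hp (s := s) (fun ω => low (k * m) (q ω)) G₀ k hks
    (fun a _ => availHat_low hqhat a) hG
  obtain ⟨A₂, hA₂, h₂⟩ := reach_hat hp (fun ω => shift (k * m) (low (k * m) (q ω) * G₀ ω)) 0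
    (A := A₁) fun i _ hi => by simpa only [coeff_shift] using h₁ i (by omega)
  obtain ⟨A₃, hA₃, h₃⟩ := reach_mul_block_zero hp (s := s) (by omega) _ H₀ h₂
    ((hH.mono hA₁.subset).mono hA₂.subset)
  obtain ⟨A₄, hA₄, h₄⟩ := reach_forall_avail (A := A₃) (fun i ω => coeff (k * m + i) (q ω)) m 1
    fun i hi B hB => by
      obtain ⟨B', hB', h⟩ := reach_sub (avail_const B 0) ((h₃ i hi).mono hB)
      refine ⟨B', hB', ?_⟩
      simpa only [zero_sub, coeff_division (hGH _) (k * m) (hq _)] using h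
  have hcoeff : AvailCoeff A₄ q (k * m) ((k + 1) * m) := fun i hi hi' => by
    rw [add_mul] at hi'
    simpa only [Nat.add_sub_cancel' hi] using h₄ (i - k * m) (by omega)
  obtain ⟨A₅, hA₅, h₅⟩ := reach_hat hp q k hcoeff
  refine ⟨A₅, ((((hA₁.trans hA₂).trans hA₃).trans hA₄).trans hA₅).weaken ?_,
    hcoeff.mono hA₅.subset, h₅⟩
  have : m ≤ 30 * s ^ 2 * m := Nat.le_mul_of_pos_left m (by have := pow_pos (show 0 < s by omega) 2; omega)
  omega

end BlockAlgorithms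

/-! ### Assembling the exponential from its blocks. -/

section ExpAlgorithm

variable {Ω : Type} {A : Set (Ω → ℂ)} {m s : ℕ}

theorem reach_euler {f : Ω → ℂ⟦X⟧} {N : ℕ} (hf : AvailCoeff A f 0 N) :
    ∃ A', Reach N A A' ∧ AvailCoeff A' (fun ω => euler (f ω)) 0 N := by
  obtain ⟨A', hA', h⟩ := reach_forall_avail (A := A) (fun i ω => coeff i (euler (f ω))) N 1
    fun i hi B hB => by
      obtain ⟨B', hB', h⟩ := reach_mul (avail_const B (i : ℂ)) ((hf i (by omega) hi).mono hB)
      exact ⟨B', hB', by simpa only [coeff_euler] using h⟩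
  exact ⟨A', hA'.weaken (by omega), fun i _ hi => h i hi⟩

theorem reach_neg {f : Ω → ℂ⟦X⟧} {N : ℕ} (hf : AvailCoeff A f 0 N) :
    ∃ A', Reach N A A' ∧ AvailCoeff A' (fun ω => -f ω) 0 N := by
  obtain ⟨A', hA', h⟩ := reach_forall_avail (A := A) (fun i ω => coeff i (-f ω)) N 1
    fun i hi B hB => by
      obtain ⟨B', hB', h⟩ := reach_sub (avail_const B 0) ((hf i (by omega) hi).mono hB)
      exact ⟨B', hB', by simpa only [zero_sub, map_neg] using h⟩
  exact ⟨A', hA'.weaken (by omega), fun i _ hi => h i hi⟩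

theorem StraightLine.ComputesExp.reach {e : StraightLine (Fin m) (Fin m)} (he : e.ComputesExp m)
    {f : Ω → ℂ⟦X⟧} (hf0 : ∀ ω, constantCoeff (f ω) = 0) (hf : AvailCoeff A f 0 m) :
    ∃ A', Reach e.cost A A' ∧ AvailCoeff A' (fun ω => expSeries (f ω)) 0 m := by
  obtain ⟨A', hA', h⟩ := e.reach (fun i ω => coeff i (f ω)) fun i => hf i (by omega) i.2
  refine ⟨A', hA', fun i _ hi => ?_⟩
  have h' := h ⟨i, hi⟩
  simp only [fun ω => he (f ω) (hf0 ω) ⟨i, hi⟩] at h'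
  exact h'

theorem reach_hats {p : StraightLine (Fin (2 * m)) (Fin (2 * m))} (hp : p.ComputesFourier (2 * m))
    (F : Ω → ℂ⟦X⟧) (N : ℕ) (hF : AvailCoeff A F 0 (N * m)) :
    ∃ A', Reach (N * p.cost) A A' ∧ ∀ k < N, AvailHat m A' F k :=
  reach_forall (fun k B => AvailHat m B F k) (fun _ _ _ h hB => h.mono hB) N p.cost
    fun k hk B hB => reach_hat hp F k fun i _ hi' =>
      (hF i (by omega) (hi'.trans_le (Nat.mul_le_mul_right m hk))).mono hB

/-- The first `s` blocks of the exponential and of its transforms. -/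
theorem reach_exp_low {p : StraightLine (Fin (2 * m)) (Fin (2 * m))}
    (hp : p.ComputesFourier (2 * m)) {D G H : Ω → ℂ⟦X⟧} (hGH : ∀ ω, G ω * H ω = 1)
    (hG : ∀ ω, euler (G ω) = D ω * G ω) (hs : 0 < s) (hD : ∀ a < s, AvailHat m A D a)
    (hG0 : AvailCoeff A G 0 m) (hH : AvailHat m A H 0) :
    ∃ A', Reach ((6 * s + 1) * p.cost + 4 * s * (30 * s ^ 2 * m)) A A' ∧
      AvailCoeff A' G 0 (s * m) ∧ ∀ a < s, AvailHat m A' G a := by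
  obtain ⟨A₁, hA₁, h₁⟩ := reach_hat hp G 0 (A := A) fun i hi hi' => hG0 i (by omega) (by omega)
  obtain ⟨A₂, hA₂, h₂, h₂'⟩ := reach_loop (A := A₁)
    (fun k B => AvailCoeff B G 0 ((k + 1) * m) ∧ ∀ a < k + 1, AvailHat m B G a) (s - 1) _
    ⟨fun i _ hi => (hG0 i (by omega) (by omega)).reach hA₁, fun a ha => by
      rwa [show a = 0 by omega]⟩
    fun k hk B hB ⟨hc, hh⟩ => by
      have hAB := hA₁.subset.trans hB
      obtain ⟨B', hB', hc', hh'⟩ := reach_exp_block hp hGH hG (k := k + 1) (s := s) (by omega)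
        (by omega) (fun a ha => (hD a (by omega)).mono hAB) hh (hH.mono hAB)
      refine ⟨B', hB', fun i hi hi' => ?_, fun a ha => ?_⟩
      · rcases lt_or_ge i ((k + 1) * m) with hik | hik
        · exact (hc i hi hik).reach hB'
        · exact hc' i hik hi'
      · rcases Nat.lt_succ_iff_lt_or_eq.mp ha with hak | rfl
        · exact (hh a hak).mono hB'.subset
        · exact hh'
  rw [Nat.sub_add_cancel hs] at h₂ h₂'
  refine ⟨A₂, (hA₁.trans hA₂).weaken ?_, h₂, h₂'⟩
  calc p.cost + (s - 1) * (6 * p.cost + 4 * (30 * s ^ 2 * m))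
      ≤ p.cost + s * (6 * p.cost + 4 * (30 * s ^ 2 * m)) := by gcongr; omega
    _ = _ := by ring

/-- The logarithmic derivative of the truncation of the exponential to `s` blocks. -/
theorem reach_logDeriv {p : StraightLine (Fin (2 * m)) (Fin (2 * m))}
    (hp : p.ComputesFourier (2 * m)) {D G G₀ H₀ : Ω → ℂ⟦X⟧} (hGH : ∀ ω, G₀ ω * H₀ ω = 1)
    (hG : ∀ ω, euler (G ω) = D ω * G ω) (hG₀ : ∀ ω, G₀ ω = low (s * m) (G ω))
    (hDc : AvailCoeff A D 0 (s * m)) (hD : ∀ a < s, AvailHat m A D a)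
    (hG₀hat : ∀ a, AvailHat m A G₀ a) (hH : AvailHat m A H₀ 0) :
    ∃ A', Reach (4 * s * p.cost + 3 * s * (30 * s ^ 2 * m)) A A' ∧
      AvailCoeff A' (fun ω => euler (G₀ ω) * H₀ ω) 0 (2 * s * m) := by
  let q : Ω → ℂ⟦X⟧ := fun ω => euler (G₀ ω) * H₀ ω
  have hq : ∀ ω i, i < s * m → coeff i (q ω) = coeff i (D ω) := fun ω i hi =>
    coeff_logDeriv_low (hG ω) (hG₀ ω) (hGH ω) hi
  obtain ⟨A', hA', h, -⟩ := reach_loop (A := A)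
    (fun k B => AvailCoeff B q 0 ((s + k) * m) ∧ ∀ a < s + k, AvailHat m B q a) s
    (4 * p.cost + 3 * (30 * s ^ 2 * m))
    -- The loop starts at block `s` without cost: below it, `q` has the coefficients of `D` and
    -- hence its transforms.
    ⟨fun i hi hi' => by simpa only [hq _ i hi'] using hDc i hi hi', fun a ha =>
      (hD a ha).congr fun ω j hj => (hq ω _ (by
        calc a * m + j < (a + 1) * m := by rw [add_mul]; omega
          _ ≤ s * m := Nat.mul_le_mul_right m ha)).symm⟩
    fun k hk B hB ⟨hc, hh⟩ => by
      obtain ⟨B', hB', hc', hh'⟩ := reach_logDeriv_block hp (s := s) (q := q) hGH (k := s + k)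
        (fun ω i => by
          -- The product is a polynomial of degree below `s * m`, which is the vanishing required by
          -- blockwise division.
          have : q ω * G₀ ω = euler (G₀ ω) := by
            simp only [q]; linear_combination euler (G₀ ω) * hGH ω
          have hle := Nat.mul_le_mul_right m (show s ≤ s + k by omega)
          rw [this, coeff_euler, hG₀, coeff_low, if_neg (by omega), mul_zero])
        (by omega) hh (fun a _ => (hG₀hat a).mono hB) (hH.mono hB)
      refine ⟨B', hB', fun i hi hi' => ?_, fun a ha => ?_⟩
      · rcases lt_or_ge i ((s + k) * m) with hik | hik
        · exact (hc i hi hik).reach hB'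
        · exact hc' i hik hi'
      · rcases Nat.lt_succ_iff_lt_or_eq.mp ha with hak | rfl
        · exact (hh a hak).mono hB'.subset
        · exact hh'
  exact ⟨A', hA'.weaken (by ring_nf; rfl), by rwa [two_mul]⟩

/-- The last `s` blocks of the exponential, by a Newton step. -/
theorem reach_newton {p : StraightLine (Fin (2 * m)) (Fin (2 * m))}
    (hp : p.ComputesFourier (2 * m)) (hsm : 0 < s * m) {D G G₀ H₀ : Ω → ℂ⟦X⟧}
    (hGH : ∀ ω, G₀ ω * H₀ ω = 1)
    (hG : ∀ ω, euler (G ω) = D ω * G ω) (hG₀ : ∀ ω, G₀ ω = low (s * m) (G ω))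
    (hD : AvailCoeff A D 0 (2 * s * m)) (hG₀hat : ∀ a, AvailHat m A G₀ a)
    (hq : AvailCoeff A (fun ω => euler (G₀ ω) * H₀ ω) 0 (2 * s * m)) :
    ∃ A', Reach (2 * s * p.cost + s * (30 * s ^ 2 * m) + 2 * s * m) A A' ∧
      AvailCoeff A' G (s * m) (2 * s * m) := by
  let Z : Ω → ℂ⟦X⟧ := fun ω => shift (s * m) (G ω * H₀ ω)
  have h2 : 2 * s * m = s * m + s * m := by ring
  have hN := fun ω => coeff_newton hsm (hG ω) (hG₀ ω) (hGH ω)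
  obtain ⟨A₁, hA₁, h₁⟩ := reach_forall_avail (A := A) (fun i ω => coeff i (Z ω)) (s * m) 2
    fun i hi B hB => by
      obtain ⟨B', hB', h⟩ := reach_sub ((hD (s * m + i) (by omega) (by omega)).mono hB)
        ((hq (s * m + i) (by omega) (by omega)).mono hB)
      obtain ⟨B'', hB'', h'⟩ := reach_mul (avail_const B' ((s * m + i : ℕ) : ℂ)⁻¹) h
      exact ⟨B'', hB'.trans hB'', by simpa only [Z, fun ω => (hN ω).2 i hi] using h'⟩
  obtain ⟨A₂, hA₂, h₂⟩ := reach_hats hp Z s (A := A₁) fun i _ hi => h₁ i hi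
  obtain ⟨A₃, hA₃, h₃⟩ := reach_forall (A := A₂)
    (fun k B => ∀ i < m, Avail B fun ω => coeff (k * m + i) (Z ω * G₀ ω))
    (fun _ _ _ h hB i hi => (h i hi).mono hB) s _ fun k hk B hB =>
      reach_mul_block hp (s := s) Z G₀ k (by omega) (fun a ha => (h₂ a (by omega)).mono hB)
        fun a _ => (hG₀hat a).mono ((hA₁.trans hA₂).subset.trans hB)
  refine ⟨A₃, ((hA₁.trans hA₂).trans hA₃).weaken (by ring_nf; rfl), fun i hi hi' => ?_⟩
  have hm : 0 < m := Nat.pos_of_mul_pos_left hsm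
  have h := h₃ ((i - s * m) / m) ((Nat.div_lt_iff_lt_mul hm).mpr (by omega)) ((i - s * m) % m)
    (Nat.mod_lt _ hm)
  simp only [Z, Nat.div_add_mod', ← fun ω => (hN ω).1] at h
  simpa only [Nat.add_sub_cancel' hi] using h

/-- The exponential to order `2 * s * m`, given the exponential to order `m`. -/
theorem reach_exp {p : StraightLine (Fin (2 * m)) (Fin (2 * m))}
    (hp : p.ComputesFourier (2 * m)) {e : StraightLine (Fin m) (Fin m)} (he : e.ComputesExp m)
    (hm : 0 < m) (hs : 0 < s) {f : Ω → ℂ⟦X⟧} (hf0 : ∀ ω, constantCoeff (f ω) = 0)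
    (hf : AvailCoeff A f 0 (2 * s * m)) :
    ∃ A', Reach (2 * e.cost + (13 * s + 2) * p.cost + 250 * s ^ 3 * m) A A' ∧
      AvailCoeff A' (fun ω => expSeries (f ω)) 0 (2 * s * m) := by
  let G : Ω → ℂ⟦X⟧ := fun ω => expSeries (f ω)
  let H : Ω → ℂ⟦X⟧ := fun ω => expSeries (-f ω)
  let D : Ω → ℂ⟦X⟧ := fun ω => euler (f ω)
  let G₀ : Ω → ℂ⟦X⟧ := fun ω => low (s * m) (G ω)
  let H₀ : Ω → ℂ⟦X⟧ := fun ω => (G₀ ω)⁻¹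
  have hsm : 0 < s * m := Nat.mul_pos hs hm
  have hmsm : m ≤ s * m := Nat.le_mul_of_pos_left m hs
  have h2 : 2 * s * m = s * m + s * m := by ring
  have hGH : ∀ ω, G ω * H ω = 1 := fun ω => expSeries_mul_expSeries_neg (hf0 ω)
  have hG : ∀ ω, euler (G ω) = D ω * G ω := fun ω => euler_expSeries (hf0 ω)
  have hGH₀ : ∀ ω, G₀ ω * H₀ ω = 1 := fun ω => PowerSeries.mul_inv_cancel _ (by
    rw [← coeff_zero_eq_constantCoeff_apply, coeff_low, if_pos hsm,
      coeff_zero_eq_constantCoeff_apply, constantCoeff_expSeries (hf0 ω)]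
    exact one_ne_zero)
  obtain ⟨A₁, hA₁, h₁⟩ := reach_euler hf
  obtain ⟨A₂, hA₂, h₂⟩ := reach_neg (A := A₁) (N := m) (f := f) fun i hi hi' =>
    (hf i hi (by omega)).reach hA₁
  obtain ⟨A₃, hA₃, h₃⟩ := he.reach (A := A₂) hf0 fun i hi hi' =>
    (hf i hi (by omega)).reach (hA₁.trans hA₂)
  obtain ⟨A₄, hA₄, h₄⟩ := he.reach (A := A₃) (f := fun ω => -f ω) (fun ω => by simp [hf0 ω])
    fun i hi hi' => (h₂ i hi hi').reach hA₃
  obtain ⟨A₅, hA₅, h₅⟩ := reach_hats hp D s (A := A₄) fun i hi hi' =>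
    (h₁ i hi (by omega)).reach ((hA₂.trans hA₃).trans hA₄)
  obtain ⟨A₆, hA₆, h₆⟩ := reach_hat hp H 0 (A := A₅) fun i hi hi' =>
    (h₄ i (by omega) (by omega)).reach hA₅
  obtain ⟨A₇, hA₇, h₇, h₇'⟩ := reach_exp_low hp hGH hG hs
    (fun a ha => (h₅ a ha).mono hA₆.subset)
    (h₃.mono ((hA₄.trans hA₅).trans hA₆).subset) h₆
  have hG₀hat : ∀ a, AvailHat m A₇ G₀ a := availHat_low h₇'
  have hD : AvailCoeff A₇ D 0 (2 * s * m) :=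
    h₁.mono (((((hA₂.trans hA₃).trans hA₄).trans hA₅).trans hA₆).trans hA₇).subset
  obtain ⟨A₈, hA₈, h₈⟩ := reach_logDeriv hp hGH₀ hG (fun _ => rfl)
    (fun i hi hi' => hD i hi (by omega)) (fun a ha => (h₅ a ha).mono (hA₆.trans hA₇).subset)
    hG₀hat ((h₆.mono hA₇.subset).congr fun ω i hi =>
      (coeff_inv_low (hGH ω) rfl (hGH₀ ω) (by omega)).symm)
  obtain ⟨A₉, hA₉, h₉⟩ := reach_newton hp hsm hGH₀ hG (fun _ => rfl) (hD.mono hA₈.subset)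
    (fun a => (hG₀hat a).mono hA₈.subset) h₈
  refine ⟨A₉, ((((((((hA₁.trans hA₂).trans hA₃).trans hA₄).trans hA₅).trans hA₆).trans
    hA₇).trans hA₈).trans hA₉).weaken ?_, fun i hi hi' => ?_⟩
  -- Transforms: `s + 1 + (6 * s + 1) + 4 * s + 2 * s = 13 * s + 2`. Pointwise work: `30 * (4 + 3 +
  -- 1) * s ^ 3 * m`, plus at most `5 * s * m` for the linear passes.
  · have h3 : s * m ≤ s ^ 3 * m := Nat.mul_le_mul_right m (Nat.le_self_pow (by norm_num) s)
    have h4 : s * (30 * s ^ 2 * m) = 30 * (s ^ 3 * m) := by ring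
    nlinarith
  · rcases lt_or_ge i (s * m) with h | h
    · exact (h₇ i hi h).reach (hA₈.trans hA₉)
    · exact h₉ i h hi'

/-- Here `Ω` is the set of admissible input series, and the values initially available are their
coefficients below `n`; the remaining ones up to `2 * s * m` are the constant zero. -/
theorem StraightLine.ComputesExp.exists_step {p : StraightLine (Fin (2 * m)) (Fin (2 * m))}
    (hp : p.ComputesFourier (2 * m)) {e : StraightLine (Fin m) (Fin m)} (he : e.ComputesExp m)
    (hm : 0 < m) (hs : 0 < s) {n : ℕ} (hn : n ≤ 2 * s * m) :
    ∃ q : StraightLine (Fin n) (Fin n), q.ComputesExp n ∧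
      q.cost ≤ 2 * e.cost + (13 * s + 2) * p.cost + 250 * s ^ 3 * m := by
  let Ω := {f : ℂ⟦X⟧ // constantCoeff f = 0}
  let a : Fin n → Ω → ℂ := fun i f => coeff i f.1
  obtain ⟨A', hA', h⟩ := reach_exp hp he hm hs (Ω := Ω) (A := Set.range a)
    (f := fun f => low n f.1) (fun f => by
      rw [← coeff_zero_eq_constantCoeff_apply, coeff_low, coeff_zero_eq_constantCoeff_apply, f.2,
        ite_self])
    (fun i _ _ => by
      simp only [coeff_low]
      by_cases hi : i < n
      · simp only [hi, if_true]
        exact Or.inl ⟨⟨i, hi⟩, rfl⟩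
      · simpa only [hi, if_false] using avail_const _ 0)
  obtain ⟨q, hq, hq'⟩ := hA'.exists_straightLine (κ := Fin n) a
    (by rintro x ⟨i, rfl⟩; exact ⟨i, rfl⟩)
    (fun k f => coeff k (expSeries (low n f.1))) fun k => h k (by omega) (by omega)
  refine ⟨q, fun f hf k => ?_, hq⟩
  rw [hq' ⟨f, hf⟩ k, coeff_expSeries_low hf k.2]
  rfl

end ExpAlgorithm

/-! ### From the recurrence to the constant `13/6`. -/

section Asymptotics

variable {E M T : ℕ → ℕ} {S : Set ℕ}

theorem Superlinear.eventually_mul_le (hM : Superlinear M) (c : ℝ) :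
    ∀ᶠ n : ℕ in atTop, c * n ≤ M n := by
  filter_upwards [hM.eventually_ge_atTop c, eventually_gt_atTop 0] with n h hn
  rwa [le_div_iff₀ (by exact_mod_cast hn)] at h

theorem Superlinear.eventually_le (hM : Superlinear M) (c : ℝ) :
    ∀ᶠ n : ℕ in atTop, c ≤ M n := by
  filter_upwards [hM.eventually_mul_le |c|, eventually_ge_atTop 1] with n h hn
  have hn' : (1 : ℝ) ≤ n := by exact_mod_cast hn
  calc c ≤ |c| := le_abs_self c
    _ ≤ |c| * n := le_mul_of_one_le_right (abs_nonneg c) hn'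
    _ ≤ M n := h

/-- The bound `L` depends on `R` but not on `K` or `n`: this keeps the number of blocks bounded
while `m` grows with `n`. -/
theorem GeometricallyDense.eventually_exists (hS : GeometricallyDense S) {R : ℕ} (hR : 0 < R)
    (K : ℕ) : ∃ L : ℕ, ∀ᶠ n : ℕ in atTop, ∃ m ∈ S, K ≤ m ∧ 0 < m ∧ R * m ≤ n ∧ n ≤ L * m := by
  obtain ⟨C, hC⟩ := hS
  have hC0 : 0 < C := by
    obtain ⟨m, -, h1, h2⟩ := hC 1 le_rfl
    exact Nat.pos_of_ne_zero (by rintro rfl; omega)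
  have hCR : 0 < C * R := Nat.mul_pos hC0 hR
  refine ⟨2 * (C * R), ?_⟩
  filter_upwards [eventually_ge_atTop ((K + 1) * (C * R))] with n hn
  have hN : K + 1 ≤ n / (C * R) := (Nat.le_div_iff_mul_le hCR).mpr hn
  obtain ⟨m, hmS, h1, h2⟩ := hC (n / (C * R)) (by omega)
  refine ⟨m, hmS, by omega, by omega, ?_, ?_⟩
  · calc R * m ≤ R * (C * (n / (C * R))) := Nat.mul_le_mul_left R h2
      _ = n / (C * R) * (C * R) := by ring
      _ ≤ n := Nat.div_mul_le_self _ _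
  · have h3 := Nat.lt_mul_div_succ n hCR
    calc n ≤ C * R * (n / (C * R) + 1) := h3.le
      _ ≤ C * R * (2 * m) := Nat.mul_le_mul_left _ (by omega)
      _ = 2 * (C * R) * m := by ring

/-- The recurrence for the cost of exponentials, with the block length chosen from `S`. -/
theorem eventually_recurrence
    (hrec : ∀ m s n, 0 < m → 0 < s → n ≤ 2 * s * m →
      E n ≤ 2 * E m + (13 * s + 2) * T (2 * m) + 250 * s ^ 3 * m)
    (hM : Superlinear M) (hMq : AlmostNondecreasingQuotient M) (hS : GeometricallyDense S)
    (hTM : Tendsto (fun n : ℕ => (T (2 * n) : ℝ) / (M n : ℝ)) (atTop ⊓ 𝓟 S) (𝓝 (1 / 3)))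
    {R : ℕ} (hR : 0 < R) {δ : ℝ} (hδ : 0 < δ) :
    ∀ᶠ n : ℕ in atTop, ∃ m : ℕ, R * m ≤ n ∧ 0 < m ∧ (R : ℝ) * M m ≤ (1 + δ) * M n ∧
      (E n : ℝ) ≤ 2 * E m + ((1 + δ) ^ 2 * (13 / 6 + 5 / R) + δ) * M n := by
  have hT : ∀ᶠ m : ℕ in atTop, m ∈ S → (T (2 * m) : ℝ) / M m ≤ (1 + δ) / 3 :=
    eventually_inf_principal.mp (hTM.eventually_le_const (by linarith))
  obtain ⟨K, hK⟩ := eventually_atTop.mp ((hT.and (hMq δ hδ)).and (hM.eventually_le 1))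
  obtain ⟨L, hL⟩ := hS.eventually_exists hR K
  filter_upwards [hL, hM.eventually_mul_le (250 * (L + 1) ^ 3 / δ), eventually_gt_atTop 0]
    with n ⟨m, hmS, hKm, hm, hRm, hnL⟩ hMn hn
  obtain ⟨⟨hTm, hQm⟩, hM1⟩ := hK m hKm
  have hmn : m ≤ n := (Nat.le_mul_of_pos_left m hR).trans hRm
  have hm' : (0 : ℝ) < m := by exact_mod_cast hm
  have hn' : (0 : ℝ) < n := by exact_mod_cast hn
  have hR' : (0 : ℝ) < R := by exact_mod_cast hR
  have hRm' : (R : ℝ) * m ≤ n := by exact_mod_cast hRm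
  have hMm : (M m : ℝ) ≤ (1 + δ) * (m / n) * M n := by
    have := hQm n hmn
    rw [div_le_iff₀ hm'] at this
    calc (M m : ℝ) ≤ _ := this
      _ = _ := by ring
  have hMn0 : (0 : ℝ) ≤ M n := Nat.cast_nonneg _
  refine ⟨m, hRm, hm, ?_, ?_⟩
  · calc (R : ℝ) * M m ≤ R * ((1 + δ) * (m / n) * M n) := by gcongr
      _ = (1 + δ) * M n * (R * m / n) := by ring
      _ ≤ (1 + δ) * M n * 1 := by
        gcongr
        exact (div_le_one hn').mpr hRm'
      _ = (1 + δ) * M n := by ring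
  -- Rounding up costs at most one extra pair of blocks: `2 * s * m ≤ n + 2 * m`.
  · set s := n / (2 * m) + 1 with hs
    have hsn : n ≤ 2 * s * m := by
      have := Nat.lt_mul_div_succ n (show 0 < 2 * m by omega)
      calc n ≤ 2 * m * (n / (2 * m) + 1) := this.le
        _ = 2 * s * m := by rw [hs]; ring
    have hsm : 2 * s * m ≤ n + 2 * m := by
      have := Nat.div_mul_le_self n (2 * m)
      calc 2 * s * m = n / (2 * m) * (2 * m) + 2 * m := by rw [hs]; ring
        _ ≤ n + 2 * m := by omega
    have hsL : s ≤ L + 1 := by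
      rw [hs]
      refine Nat.succ_le_succ (Nat.div_le_of_le_mul ?_)
      calc n ≤ L * m := hnL
        _ ≤ 2 * m * L := by nlinarith [Nat.zero_le (L * m)]
    have hsm' : 2 * (s : ℝ) * m ≤ n + 2 * m := by exact_mod_cast hsm
    have hsL' : (s : ℝ) ≤ L + 1 := by exact_mod_cast hsL
    have hE : (E n : ℝ) ≤ 2 * E m + (13 * s + 2) * T (2 * m) + 250 * s ^ 3 * m := by
      exact_mod_cast hrec m s n hm (Nat.succ_pos _) hsn
    have hTm' : (T (2 * m) : ℝ) ≤ (1 + δ) / 3 * M m := by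
      have := hTm hmS
      rwa [div_le_iff₀ (by linarith)] at this
    have h1 : (13 * (s : ℝ) + 2) * T (2 * m) ≤ (1 + δ) ^ 2 * (13 / 6 + 5 / R) * M n := by
      -- From `2 * s * m ≤ n + 2 * m` the excess is `13 * m + 2 * m = 15 * m`; division by three
      -- later turns it into `5 / R`.
      have h2 : (13 * (s : ℝ) + 2) * m ≤ (13 / 2 + 15 / R) * n := by
        have : (m : ℝ) ≤ n / R := by rw [le_div_iff₀ hR']; linarith
        calc (13 * (s : ℝ) + 2) * m ≤ 13 / 2 * n + 15 * m := by linarith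
          _ ≤ 13 / 2 * n + 15 * (n / R) := by linarith
          _ = (13 / 2 + 15 / R) * n := by ring
      calc (13 * (s : ℝ) + 2) * T (2 * m)
          ≤ (13 * s + 2) * ((1 + δ) / 3 * ((1 + δ) * (m / n) * M n)) := by
            gcongr
            exact hTm'.trans (by gcongr)
        _ = (1 + δ) ^ 2 / 3 * M n * ((13 * s + 2) * m / n) := by ring
        _ ≤ (1 + δ) ^ 2 / 3 * M n * (13 / 2 + 15 / R) := by
            gcongr
            rwa [div_le_iff₀ hn']
        _ = _ := by ring
    have h3 : 250 * (s : ℝ) ^ 3 * m ≤ δ * M n := by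
      calc 250 * (s : ℝ) ^ 3 * m ≤ 250 * ((L : ℝ) + 1) ^ 3 * n := by
            gcongr
        _ = δ * (250 * (L + 1) ^ 3 / δ * n) := by field_simp
        _ ≤ δ * M n := by gcongr
    linarith

/-- Strong induction: the two recursive calls contribute at most half of the bound for `M n`,
because `M m ≤ M n / 4`. -/
theorem exists_linear_bound
    (hM : Superlinear M) (hrec : ∀ᶠ n : ℕ in atTop, ∃ m : ℕ, 8 * m ≤ n ∧ 0 < m ∧
      8 * (M m : ℝ) ≤ 2 * M n ∧ (E n : ℝ) ≤ 2 * E m + 13 * M n) :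
    ∃ B : ℝ, 0 ≤ B ∧ ∀ n, (E n : ℝ) ≤ B * (M n + 1) := by
  obtain ⟨n₁, h₁⟩ := eventually_atTop.mp (hrec.and (hM.eventually_le 4))
  have hsum : (0 : ℝ) ≤ ∑ i ∈ Finset.range n₁, (E i : ℝ) :=
    Finset.sum_nonneg fun _ _ => Nat.cast_nonneg _
  -- The induction needs `B * M n / 2 ≥ B + 13 * M n`; this follows from `M n ≥ 4` and `B ≥ 52`. The
  -- sum covers the finitely many small `n`.
  refine ⟨52 + ∑ i ∈ Finset.range n₁, (E i : ℝ), by linarith, fun n => ?_⟩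
  set B := 52 + ∑ i ∈ Finset.range n₁, (E i : ℝ) with hB
  induction n using Nat.strong_induction_on with
  | _ n ih =>
    have hMn : (0 : ℝ) ≤ M n := Nat.cast_nonneg _
    rcases lt_or_ge n n₁ with hn | hn
    · have : (E n : ℝ) ≤ ∑ i ∈ Finset.range n₁, (E i : ℝ) :=
        Finset.single_le_sum (f := fun i => (E i : ℝ)) (fun _ _ => Nat.cast_nonneg _)
          (Finset.mem_range.mpr hn)
      nlinarith
    · obtain ⟨⟨m, hmn, hm, hMm, hE⟩, hM4⟩ := h₁ n hn
      have := ih m (by omega)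
      nlinarith

/-- The recurrence implies the asymptotic bound. -/
theorem eventually_cost_le
    (hrec : ∀ m s n, 0 < m → 0 < s → n ≤ 2 * s * m →
      E n ≤ 2 * E m + (13 * s + 2) * T (2 * m) + 250 * s ^ 3 * m)
    (hM : Superlinear M) (hMq : AlmostNondecreasingQuotient M) (hS : GeometricallyDense S)
    (hTM : Tendsto (fun n : ℕ => (T (2 * n) : ℝ) / (M n : ℝ)) (atTop ⊓ 𝓟 S) (𝓝 (1 / 3)))
    {ε : ℝ} (hε : 0 < ε) : ∀ᶠ n : ℕ in atTop, (E n : ℝ) ≤ (13 / 6 + ε) * M n := by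
  obtain ⟨B, hB0, hB⟩ : ∃ B : ℝ, 0 ≤ B ∧ ∀ n, (E n : ℝ) ≤ B * (M n + 1) := by
    refine exists_linear_bound hM ?_
    -- With `R = 8` and `δ = 1` the coefficient is `4 * (13/6 + 5/8) + 1 < 13`.
    filter_upwards [eventually_recurrence hrec hM hMq hS hTM (R := 8) (by norm_num) one_pos]
      with n ⟨m, h1, h2, h3, h4⟩
    refine ⟨m, h1, h2, by norm_num at h3 ⊢; linarith, h4.trans ?_⟩
    have hMn : (0 : ℝ) ≤ M n := Nat.cast_nonneg _
    norm_num
    nlinarith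
  obtain ⟨R, hR⟩ := exists_nat_gt (max 1 (2 * (5 + 4 * B) / ε))
  obtain ⟨hR1, hR2⟩ := max_lt_iff.mp hR
  have hR0 : (0 : ℝ) < R := by linarith
  -- The errors in `δ` total at most `26 * δ`, half of `ε`; the choice of `R` keeps `(5 + 4 * B) /
  -- R` within the other half.
  set δ := min 1 (ε / 52) with hδ
  have hδ0 : 0 < δ := lt_min one_pos (by positivity)
  have hδ1 : δ ≤ 1 := min_le_left _ _
  have hδ2 : 26 * δ ≤ ε / 2 := by
    have := min_le_right 1 (ε / 52)
    rw [hδ]; linarith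
  filter_upwards [eventually_recurrence hrec hM hMq hS hTM (R := R) (by exact_mod_cast hR0) hδ0,
    hM.eventually_le (2 * B / δ)] with n ⟨m, _, _, hMm, hE⟩ hMn
  have hMn0 : (0 : ℝ) ≤ M n := Nat.cast_nonneg _
  have h1 : 2 * B ≤ δ * M n := by rwa [div_le_iff₀' hδ0] at hMn
  have h2 : (M m : ℝ) ≤ 2 * M n / R := by
    rw [le_div_iff₀ hR0]
    nlinarith
  have h3 : 2 * (E m : ℝ) ≤ (4 * B / R + δ) * M n := by
    calc 2 * (E m : ℝ) ≤ 2 * (B * (M m + 1)) := by linarith [hB m]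
      _ ≤ 2 * (B * (2 * M n / R + 1)) := by gcongr
      _ = 4 * B / R * M n + 2 * B := by ring
      _ ≤ 4 * B / R * M n + δ * M n := by linarith
      _ = _ := by ring
  have h4 : (5 + 4 * B) / R ≤ ε / 2 := by
    rw [div_lt_iff₀ hε] at hR2
    rw [div_le_iff₀ hR0]
    linarith
  have h5 : (5 : ℝ) / R ≤ 5 := div_le_self (by norm_num) hR1.le
  have h6 : (1 + δ) ^ 2 * (13 / 6 + 5 / R) + δ + (4 * B / R + δ) ≤ 13 / 6 + ε := by
    have h7 : (1 + δ) ^ 2 ≤ 1 + 3 * δ := by nlinarith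
    have h8 : (0 : ℝ) ≤ 5 / R := by positivity
    calc (1 + δ) ^ 2 * (13 / 6 + 5 / R) + δ + (4 * B / R + δ)
        ≤ (1 + 3 * δ) * (13 / 6 + 5 / R) + δ + (4 * B / R + δ) := by gcongr
      _ = 13 / 6 + 3 * δ * (13 / 6 + 5 / R) + 2 * δ + (5 + 4 * B) / R := by ring
      _ ≤ 13 / 6 + 3 * δ * 8 + 2 * δ + ε / 2 := by gcongr; linarith
      _ ≤ 13 / 6 + ε := by linarith
  calc (E n : ℝ) ≤ ((1 + δ) ^ 2 * (13 / 6 + 5 / R) + δ + (4 * B / R + δ)) * M n := by linarith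
    _ ≤ (13 / 6 + ε) * M n := by gcongr

end Asymptotics

/-! ### Programs of minimal cost and the conclusion. -/

open PowerSeries in
-- To order one the exponential is the constant `1`; a single step with blocks of length one then
-- reaches any order.
theorem exists_computesExp (fftAlg : (n : ℕ) → StraightLine (Fin n) (Fin n))
    (hfft : ∀ n, (fftAlg n).ComputesFourier n) (n : ℕ) :
    ∃ q : StraightLine (Fin n) (Fin n), q.ComputesExp n := by
  have h1 : (StraightLine.output fun _ => Sum.inr 1 : StraightLine (Fin 1) (Fin 1)).ComputesExp 1 :=
    fun f hf k => by
      have h0 : (k : ℕ) = 0 := by omega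
      have : coeff (k : ℕ) (expSeries f) = 1 := by
        rw [h0, coeff_zero_eq_constantCoeff_apply, constantCoeff_expSeries hf]
      exact this.symm
  obtain ⟨q, hq, -⟩ := h1.exists_step (hfft (2 * 1)) one_pos n.succ_pos (n := n) (by omega)
  exact ⟨q, hq⟩

/-- With minimal programs, the cost satisfies the recurrence for every choice of `m` and `s` at
once, so no recursive construction has to fix these parameters. -/
theorem exists_computesExp_minimal {n : ℕ}
    (h : ∃ q : StraightLine (Fin n) (Fin n), q.ComputesExp n) :
    ∃ e : StraightLine (Fin n) (Fin n), e.ComputesExp n ∧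
      ∀ q : StraightLine (Fin n) (Fin n), q.ComputesExp n → e.cost ≤ q.cost := by
  classical
  have hc : ∃ c, ∃ q : StraightLine (Fin n) (Fin n), q.ComputesExp n ∧ q.cost = c :=
    h.elim fun q hq => ⟨_, q, hq, rfl⟩
  obtain ⟨e, he, hec⟩ := Nat.find_spec hc
  exact ⟨e, he, fun q hq => hec ▸ Nat.find_min' hc ⟨q, hq, rfl⟩⟩

end

theorem mainTheorem1
    (mulAlg : (n : ℕ) → StraightLine (Fin (2 * n)) (Fin n ⊕ Fin n))
    (hmul : ∀ n, (mulAlg n).Multiplies n)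
    (fftAlg : (n : ℕ) → StraightLine (Fin n) (Fin n))
    (hfft : ∀ n, (fftAlg n).ComputesFourier n)
    (M T : ℕ → ℕ)
    (hM : ∀ n, M n = (mulAlg n).cost)
    (hT : ∀ n, T n = (fftAlg n).cost)
    (hM_superlinear : Superlinear M)
    (hM_quotient : AlmostNondecreasingQuotient M)
    (S : Set ℕ) (hS : GeometricallyDense S)
    (hTM : Tendsto (fun n : ℕ => (T (2 * n) : ℝ) / (M n : ℝ)) (atTop ⊓ 𝓟 S) (𝓝 (1 / 3))) :
    ∃ expAlg : (n : ℕ) → StraightLine (Fin n) (Fin n),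
      (∀ n, (expAlg n).ComputesExp n) ∧
      ∃ η : ℕ → ℝ, Tendsto η atTop (𝓝 0) ∧
        ∀ᶠ n : ℕ in atTop, ((expAlg n).cost : ℝ) ≤ (13 / 6 + η n) * (M n : ℝ) := by
  choose expAlg hexp hmin using fun n => exists_computesExp_minimal (exists_computesExp fftAlg hfft n)
  have hrec : ∀ m s n, 0 < m → 0 < s → n ≤ 2 * s * m →
      (expAlg n).cost ≤ 2 * (expAlg m).cost + (13 * s + 2) * T (2 * m) + 250 * s ^ 3 * m := by
    intro m s n hm hs hn
    obtain ⟨q, hq, hcost⟩ := (hexp m).exists_step (hfft (2 * m)) hm hs hn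
    rw [hT]
    exact (hmin n q hq).trans hcost
  -- The error is the excess of the cost ratio over `13/6`, cut off at zero since the ratio may be
  -- smaller.
  refine ⟨expAlg, hexp, fun n => max 0 ((expAlg n).cost / M n - 13 / 6), ?_, ?_⟩
  · rw [Metric.tendsto_nhds]
    intro ε hε
    filter_upwards [eventually_cost_le hrec hM_superlinear hM_quotient hS hTM (half_pos hε),
      hM_superlinear.eventually_le 1] with n h h1
    have h2 : ((expAlg n).cost : ℝ) / M n ≤ 13 / 6 + ε / 2 := by
      rwa [div_le_iff₀ (by linarith)]
    rw [Real.dist_eq, sub_zero, abs_of_nonneg (le_max_left _ _)]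
    exact max_lt hε (by linarith)
  · filter_upwards [hM_superlinear.eventually_le 1] with n h1
    have h2 : (0 : ℝ) < M n := by linarith
    rw [← div_le_iff₀ h2]
    linarith [le_max_right 0 (((expAlg n).cost : ℝ) / M n - 13 / 6)]
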